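/- Let $N\ge 1$, let $1\le p<\infty$ and let $K\subset\mathbf R^N$ be compact. For an open set $\Omega\subset\mathbf R^N$ let $W^{1,p}(\Omega,\mathbf R^N)$ be the set of functions $u:\mathbf R^N\to\mathbf R$ whose restriction to $\Omega$ lies in $L^p(\Omega)$ and has weak first partial derivatives in $L^p(\Omega)$, and put $W^{1,p}(\mathbf R^N)=W^{1,p}(\mathbf R^N,\mathbf R^N)$. The $(1,p)$-capacity of a compact set $F\subset\mathbf R^N$ is $$C_{1,p}(F)=\inf\Big\{\|\varphi\|_{L^p(\mathbf R^N)}+\sum_{j=1}^N\|D_j\varphi\|_{L^p(\mathbf R^N)}:\ \varphi\in C_c^\infty(\mathbf R^N),\ \varphi\ge 1\text{ on }F\Big\},$$ and for an open set $\omega$ one puts $C_{1,p}(\omega)=\sup\{C_{1,p}(F):F\subset\omega\text{ compact}\}$. Let $Q$ be the set of Lebesgue measurable functions $u:\mathbf R^N\to\mathbf R$ that are quasicontinuous: for every $\varepsilon>0$ there is an open set $\omega$ with $C_{1,p}(\omega)<\varepsilon$ such that the restriction of $u$ to $\mathbf R^N\setminus\omega$ is continuous. The compact set $K$ has the $J_p$-property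 if $$Q\cap W^{1,p}(\mathbf R^N\setminus K,\mathbf R^N)=Q\cap W^{1,p}(\mathbf R^N),$$ and the $J_p(\mathrm{cont})$-property if the same equality holds with $Q$ replaced by the set $C(\mathbf R^N)$ of real continuous functions on $\mathbf R^N$. (i) If the $J_p$-property fails for $K$, or if the $J_p(\mathrm{cont})$-property fails for $K$, then there are a vector $v\ne 0$ and a Borel set $A$ in the hyperplane $v^\perp$ of positive $(N-1)$-dimensional Lebesgue measure such that for every $y\in A$ the line $y+\mathbf Rv$ meets $K$ in uncountably many points. (For $N=1$ the hyperplane is a single point, of measure $1$.) (ii) A singular function on a line has uncountable support: if $f:\mathbf R\to\mathbf R$ is continuous and not constant and $f'(t)=0$ for almost every $t$, then the set of points of $\mathbf R$ that have no neighbourhood on which $f$ is constant is uncountable. -/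

import Mathlib

open MeasureTheory Set Filter Topology
open scoped ContDiff ENNReal

noncomputable section

namespace SobolevRemovability

/-- The `j`-th classical partial derivative of a function on `ℝ^N`. -/
def partialDeriv {N : ℕ} (j : Fin N) (φ : EuclideanSpace ℝ (Fin N) → ℝ)
    (x : EuclideanSpace ℝ (Fin N)) : ℝ :=
  fderiv ℝ φ x (EuclideanSpace.single j 1)

/-- `g` is a weak `j`-th partial derivative of `u` on the open set `Ω`, tested against
`C_c^∞(Ω)`. (It is used only for `u` and `g` in `L^p(Ω)`, `p ≥ 1`, so both integrals converge.) -/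
def IsWeakPartialDeriv {N : ℕ} (Ω : Set (EuclideanSpace ℝ (Fin N))) (j : Fin N)
    (u g : EuclideanSpace ℝ (Fin N) → ℝ) : Prop :=
  ∀ φ : EuclideanSpace ℝ (Fin N) → ℝ, ContDiff ℝ ∞ φ → HasCompactSupport φ → tsupport φ ⊆ Ω →
    ∫ x in Ω, u x * partialDeriv j φ x = - ∫ x in Ω, g x * φ x

/-- The functions `u : ℝ^N → ℝ` whose restriction to the open set `Ω` lies in the Sobolev space
`W^{1,p}(Ω)`. For `Ω = ℝ^N` this is `W^{1,p}(ℝ^N)`. Members are functions, not classes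
modulo null sets. -/
def sobolev {N : ℕ} (p : ℝ) (Ω : Set (EuclideanSpace ℝ (Fin N))) :
    Set (EuclideanSpace ℝ (Fin N) → ℝ) :=
  {u | MemLp u (ENNReal.ofReal p) (volume.restrict Ω) ∧
    ∀ j : Fin N, ∃ g : EuclideanSpace ℝ (Fin N) → ℝ,
      MemLp g (ENNReal.ofReal p) (volume.restrict Ω) ∧ IsWeakPartialDeriv Ω j u g}

/-- The `(1,p)`-capacity of a compact set `F`: the infimum of
`‖φ‖_p + ∑_j ‖D_j φ‖_p` over `φ ∈ C_c^∞(ℝ^N)` with `φ ≥ 1` on `F`. -/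
def capCompact {N : ℕ} (p : ℝ) (F : Set (EuclideanSpace ℝ (Fin N))) : ℝ≥0∞ :=
  ⨅ (φ : EuclideanSpace ℝ (Fin N) → ℝ) (_ : ContDiff ℝ ∞ φ) (_ : HasCompactSupport φ)
    (_ : ∀ x ∈ F, 1 ≤ φ x),
    (eLpNorm φ (ENNReal.ofReal p) volume +
      ∑ j : Fin N, eLpNorm (partialDeriv j φ) (ENNReal.ofReal p) volume)

/-- The `(1,p)`-capacity of an open set: the supremum over its compact subsets. -/
def capOpen {N : ℕ} (p : ℝ) (U : Set (EuclideanSpace ℝ (Fin N))) : ℝ≥0∞ :=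
  ⨆ (F : Set (EuclideanSpace ℝ (Fin N))) (_ : IsCompact F) (_ : F ⊆ U), capCompact p F

/-- The Lebesgue measurable functions on `ℝ^N` that are quasicontinuous with respect to the
`(1,p)`-capacity. -/
def quasicontinuous (N : ℕ) (p : ℝ) : Set (EuclideanSpace ℝ (Fin N) → ℝ) :=
  {u | AEMeasurable u volume ∧
    ∀ ε : ℝ≥0∞, 0 < ε → ∃ U : Set (EuclideanSpace ℝ (Fin N)),
      IsOpen U ∧ capOpen p U < ε ∧ ContinuousOn u Uᶜ}

/-- The `J_p`-property of a compact set `K`, formulated with quasicontinuous functions. -/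
def JProperty {N : ℕ} (p : ℝ) (K : Set (EuclideanSpace ℝ (Fin N))) : Prop :=
  quasicontinuous N p ∩ sobolev p Kᶜ = quasicontinuous N p ∩ sobolev p univ

/-- The `J_p(cont)`-property of a compact set `K`, formulated with continuous functions. -/
def JPropertyCont {N : ℕ} (p : ℝ) (K : Set (EuclideanSpace ℝ (Fin N))) : Prop :=
  {u | Continuous u} ∩ sobolev p Kᶜ = {u | Continuous u} ∩ sobolev p univ

/-- Lebesgue measure on the hyperplane `v^⊥`. A line parallel to `v ≠ 0` is identified with
its unique point in `v^⊥`, so this is the `(N-1)`-dimensional measure on these lines. -/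
def lineMeasure {N : ℕ} (v : EuclideanSpace ℝ (Fin N)) :
    Measure ((Submodule.span ℝ {v})ᗮ : Submodule ℝ (EuclideanSpace ℝ (Fin N))) :=
  (stdOrthonormalBasis ℝ
    ((Submodule.span ℝ {v})ᗮ : Submodule ℝ (EuclideanSpace ℝ (Fin N)))).toBasis.addHaar

/-- The line through `y` with direction `v`. -/
def lineThrough {N : ℕ} (y v : EuclideanSpace ℝ (Fin N)) : Set (EuclideanSpace ℝ (Fin N)) :=
  {x | ∃ t : ℝ, x = y + t • v}

/-- A singular function on the line: continuous, not constant, with derivative zero at almost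
every point. -/
def IsSingularFunction (f : ℝ → ℝ) : Prop :=
  Continuous f ∧ (∃ a b, f a ≠ f b) ∧ ∀ᵐ t : ℝ, HasDerivAt f 0 t

/-- The support of a singular function, i.e. the support of its distributional derivative:
the set of points that have no neighbourhood on which `f` is constant. -/
def singularSupport (f : ℝ → ℝ) : Set ℝ :=
  {t | ¬ ∀ᶠ s in 𝓝 t, f s = f t}

end SobolevRemovability

end

/-! Membership in `W^{1,p}` is read off on lines parallel to the coordinate axes. On almost every
such line an admissible `u` is continuous, and off `K` it differs from a primitive of its weak
derivative by a locally constant function. If the line meets `K` in a countable set, that difference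
is a continuous function, locally constant off a countable set; it takes countably many values, so
by connectedness it is constant (`eq_of_eventually_eq_off_countable`). Such a line does not see `K`,
and Fubini reassembles the weak derivative on the whole space. Hence a failure of removability
forces uncountable sections on a positive family of lines, and `v` may be taken to be a basis
vector. Part (ii) is the same one-dimensional fact.

Two further points carry the argument. Projecting an open set along an axis gives a set of measure
at most its capacity to the power `p`, so quasicontinuous functions are continuous on almost every
line (`ae_continuous_slice_of_quasicontinuous`). The set of lines with countable section is never
shown to be measurable; `measure_eq_zero_of_ae_imp_notMem` replaces that measurability. -/

noncomputable section
namespace SobolevRemovability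

/-! ### Continuous functions that are locally constant off a countable set -/

/-- A continuous real function that is locally constant off a countable set is constant. -/
theorem eq_of_eventually_eq_off_countable {F : ℝ → ℝ} (hF : Continuous F) {S : Set ℝ}
    (hS : S.Countable) (h : ∀ t ∉ S, ∀ᶠ s in 𝓝 t, F s = F t) (a b : ℝ) : F a = F b := by
  -- Off `S`, every value of `F` is already taken at a nearby rational.
  have hc : (range F).Countable := by
    refine ((hS.image F).union (countable_range fun q : ℚ => F q)).mono ?_
    rintro _ ⟨t, rfl⟩
    by_cases ht : t ∈ S
    · exact Or.inl ⟨t, ht, rfl⟩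
    · obtain ⟨q, hq⟩ := Rat.denseRange_cast.exists_mem_open isOpen_interior
        ⟨t, mem_interior_iff_mem_nhds.2 (h t ht)⟩
      have hqt := interior_subset hq
      exact Or.inr ⟨q, hqt⟩
  by_contra hab
  rcases lt_or_gt_of_ne hab with hlt | hlt
  · refine (Cardinal.Real.Icc_countable_iff.1 (hc.mono ?_)).not_gt hlt
    exact (isPreconnected_range hF).ordConnected.out (mem_range_self _) (mem_range_self _)
  · refine (Cardinal.Real.Icc_countable_iff.1 (hc.mono ?_)).not_gt hlt
    exact (isPreconnected_range hF).ordConnected.out (mem_range_self _) (mem_range_self _)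

/-- A continuous function whose singular support is countable is constant. -/
theorem not_countable_singularSupport {f : ℝ → ℝ} (hf : IsSingularFunction f) :
    ¬ (singularSupport f).Countable := by
  intro hc
  obtain ⟨hcont, ⟨a, b, hab⟩, -⟩ := hf
  exact hab (eq_of_eventually_eq_off_countable hcont hc (fun t ht => not_not.1 ht) a b)

/-! ### Weak derivatives on the line -/

/-- Integration by parts for a primitive of a locally integrable function against a compactly
supported test function. -/
theorem integral_mul_deriv_of_eq_integral {u g : ℝ → ℝ} (hg : LocallyIntegrable g) {C : ℝ}
    (hu : ∀ t, u t = C + ∫ s in (0 : ℝ)..t, g s) {ψ : ℝ → ℝ} (hψ : ContDiff ℝ ∞ ψ)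
    (hψc : HasCompactSupport ψ) :
    ∫ t, u t * deriv ψ t = - ∫ t, g t * ψ t := by
  obtain ⟨R, hR⟩ := hψc.isCompact.isBounded.subset_closedBall 0
  have hsub : tsupport ψ ⊆ Ioo (-(|R| + 1)) (|R| + 1) := fun x hx => by
    have := hR hx
    rw [mem_closedBall_zero_iff, Real.norm_eq_abs] at this
    have := this.trans (le_abs_self R)
    exact abs_lt.1 (by linarith)
  -- The extra 1 puts the support in the open interval, so the boundary terms vanish; the absolute
  -- value keeps `b` positive even when `R` is negative.
  set b := |R| + 1
  have hb : 0 < b := by positivity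
  have hsub' : tsupport ψ ⊆ Ioc (-b) b := hsub.trans Ioo_subset_Ioc_self
  have e1 : ∫ t, u t * deriv ψ t = ∫ t in (-b)..b, u t * deriv ψ t := by
    rw [intervalIntegral.integral_of_le (by linarith), setIntegral_eq_integral_of_forall_compl_eq_zero]
    intro x hx
    rw [image_eq_zero_of_notMem_tsupport fun h => hx (hsub' (tsupport_deriv_subset h)), mul_zero]
  have e2 : ∫ t, g t * ψ t = ∫ t in (-b)..b, g t * ψ t := by
    rw [intervalIntegral.integral_of_le (by linarith), setIntegral_eq_integral_of_forall_compl_eq_zero]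
    intro x hx
    rw [image_eq_zero_of_notMem_tsupport fun h => hx (hsub' h), mul_zero]
  have hint : IntervalIntegrable g volume (-b) b := (hg.integrableOn_isCompact isCompact_uIcc).intervalIntegrable
  have hu' : u = fun t => C + ∫ s in (0 : ℝ)..t, g s := funext hu
  -- `g` is only locally integrable, so integration by parts is done for absolutely continuous
  -- functions.
  have hac : AbsolutelyContinuousOnInterval u (-b) b := by
    have h0 := hint.absolutelyContinuousOnInterval_intervalIntegral (c := 0)
      (by rw [uIcc_of_le (by linarith)]; constructor <;> linarith)
    have hC : AbsolutelyContinuousOnInterval (fun _ : ℝ => C) (-b) b :=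
      (LipschitzWith.const C).lipschitzOnWith.absolutelyContinuousOnInterval
    rw [hu']
    exact hC.fun_add h0
  have hψac : AbsolutelyContinuousOnInterval ψ (-b) b := by
    obtain ⟨L, hL⟩ := ContDiff.lipschitzWith_of_hasCompactSupport hψc hψ (by simp)
    exact hL.lipschitzOnWith.absolutelyContinuousOnInterval
  have hd : ∀ᵐ t, deriv u t = g t := by
    filter_upwards [_root_.LocallyIntegrable.ae_hasDerivAt_integral hg] with t ht
    rw [hu']
    exact ((ht 0).const_add C).deriv
  rw [e1, e2, hac.integral_mul_deriv_eq_deriv_mul hψac,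
    image_eq_zero_of_notMem_tsupport fun h => (hsub h).2.false,
    image_eq_zero_of_notMem_tsupport fun h => (hsub h).1.false]
  simp only [mul_zero, sub_self, zero_sub, neg_inj]
  refine intervalIntegral.integral_congr_ae ?_
  filter_upwards [hd] with t ht _
  rw [ht]

/-- A smooth function equal to one on `[c + 1/k, d]` and to zero off `[c, d + 1/k]`. -/
def plateau (k c d t : ℝ) : ℝ :=
  Real.smoothTransition (k * (t - c)) - Real.smoothTransition (k * (t - d))

theorem contDiff_plateau (k c d : ℝ) : ContDiff ℝ ∞ (plateau k c d) :=
  (Real.smoothTransition.contDiff.comp (by fun_prop)).sub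
    (Real.smoothTransition.contDiff.comp (by fun_prop))

theorem plateau_eq_zero_of_le {k c d t : ℝ} (hk : 0 < k) (hcd : c ≤ d) (ht : t ≤ c) :
    plateau k c d t = 0 := by
  rw [plateau, Real.smoothTransition.zero_of_nonpos (by nlinarith),
    Real.smoothTransition.zero_of_nonpos (by nlinarith), sub_zero]

theorem plateau_eq_zero_of_ge {k c d t : ℝ} (hk : 0 < k) (hcd : c ≤ d) (ht : d + 1 / k ≤ t) :
    plateau k c d t = 0 := by
  have h1 : 1 ≤ k * (t - d) := by
    have : k * (1 / k) ≤ k * (t - d) := by gcongr; linarith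
    rwa [mul_one_div_cancel hk.ne'] at this
  rw [plateau, Real.smoothTransition.one_of_one_le (by nlinarith),
    Real.smoothTransition.one_of_one_le h1, sub_self]

theorem tsupport_plateau_subset {k c d : ℝ} (hk : 0 < k) (hcd : c ≤ d) :
    tsupport (plateau k c d) ⊆ Icc c (d + 1 / k) := by
  refine closure_minimal (fun t ht => ?_) isClosed_Icc
  constructor
  · by_contra h
    exact ht (plateau_eq_zero_of_le hk hcd (not_le.1 h).le)
  · by_contra h
    exact ht (plateau_eq_zero_of_ge hk hcd (not_le.1 h).le)

theorem hasCompactSupport_plateau {k c d : ℝ} (hk : 0 < k) (hcd : c ≤ d) :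
    HasCompactSupport (plateau k c d) :=
  isCompact_Icc.of_isClosed_subset (isClosed_tsupport _) (tsupport_plateau_subset hk hcd)

theorem abs_plateau_le_one (k c d t : ℝ) : |plateau k c d t| ≤ 1 := by
  have h1 := Real.smoothTransition.nonneg (k * (t - c))
  have h2 := Real.smoothTransition.nonneg (k * (t - d))
  have h3 := Real.smoothTransition.le_one (k * (t - c))
  have h4 := Real.smoothTransition.le_one (k * (t - d))
  rw [plateau, abs_le]
  constructor <;> linarith

theorem deriv_smoothTransition_eq_zero {r : ℝ} (hr : r ∉ Icc (0 : ℝ) 1) :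
    deriv Real.smoothTransition r = 0 := by
  rw [mem_Icc, not_and_or, not_le, not_le] at hr
  rcases hr with hr | hr
  · have : Real.smoothTransition =ᶠ[𝓝 r] fun _ => 0 := by
      filter_upwards [Iio_mem_nhds hr] with x hx
      exact Real.smoothTransition.zero_of_nonpos (le_of_lt hx)
    rw [this.deriv_eq, deriv_const]
  · have : Real.smoothTransition =ᶠ[𝓝 r] fun _ => 1 := by
      filter_upwards [Ioi_mem_nhds hr] with x hx
      exact Real.smoothTransition.one_of_one_le (le_of_lt hx)
    rw [this.deriv_eq, deriv_const]

theorem continuous_deriv_smoothTransition : Continuous (deriv Real.smoothTransition) :=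
  (Real.smoothTransition.contDiff (n := 1)).continuous_deriv le_rfl

theorem hasCompactSupport_deriv_smoothTransition :
    HasCompactSupport (deriv Real.smoothTransition) :=
  HasCompactSupport.intro isCompact_Icc fun _ => deriv_smoothTransition_eq_zero

theorem differentiable_smoothTransition : Differentiable ℝ Real.smoothTransition :=
  (Real.smoothTransition.contDiff (n := 1)).differentiable (by simp)

theorem integral_deriv_smoothTransition : ∫ r, deriv Real.smoothTransition r = 1 := by
  have h := integral_of_hasDerivAt_of_tendsto (f := Real.smoothTransition) (m := 0) (n := 1)
    (fun x => (differentiable_smoothTransition x).hasDerivAt)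
    (continuous_deriv_smoothTransition.integrable_of_hasCompactSupport
      hasCompactSupport_deriv_smoothTransition)
    (tendsto_const_nhds.congr' ?_) (tendsto_const_nhds.congr' ?_)
  · simpa using h
  · filter_upwards [eventually_le_atBot 0] with x hx
    exact (Real.smoothTransition.zero_of_nonpos hx).symm
  · filter_upwards [eventually_ge_atTop 1] with x hx
    exact (Real.smoothTransition.one_of_one_le hx).symm

/-- The derivatives of steep smooth steps at `c` are an approximate identity at `c`. -/
theorem tendsto_integral_mul_deriv_smoothTransition {u : ℝ → ℝ} (hu : Continuous u) (c : ℝ) :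
    Tendsto (fun n : ℕ => ∫ t, u t *
      (((n : ℝ) + 1) * deriv Real.smoothTransition (((n : ℝ) + 1) * (t - c)))) atTop
      (𝓝 (u c)) := by
  -- The substitution `t = c + r / (n + 1)` moves `n` from the kernel into the argument of `u`,
  -- which stays in `[c, c + 1]` on the support of the kernel; dominated convergence then applies.
  have hsub : ∀ n : ℕ, ∫ t, u t *
      (((n : ℝ) + 1) * deriv Real.smoothTransition (((n : ℝ) + 1) * (t - c))) =
      ∫ r, u (c + r / ((n : ℝ) + 1)) * deriv Real.smoothTransition r := by
    intro n
    have hk : (0 : ℝ) < n + 1 := by positivity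
    rw [← integral_add_right_eq_self _ c]
    have h := Measure.integral_comp_mul_left
      (fun r => u (c + r / ((n : ℝ) + 1)) * deriv Real.smoothTransition r) ((n : ℝ) + 1)
    rw [abs_of_pos (by positivity), smul_eq_mul, eq_comm, inv_mul_eq_iff_eq_mul₀ hk.ne'] at h
    rw [h, ← integral_const_mul]
    congr 1 with t
    rw [add_sub_cancel_right, mul_div_cancel_left₀ _ hk.ne', add_comm t c]
    ring
  simp_rw [hsub]
  obtain ⟨C, hC⟩ := (isCompact_Icc (a := c) (b := c + 1)).exists_bound_of_continuousOn
    hu.continuousOn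
  have hlim : u c = ∫ r, u c * deriv Real.smoothTransition r := by
    rw [integral_const_mul, integral_deriv_smoothTransition, mul_one]
  rw [hlim]
  refine tendsto_integral_of_dominated_convergence
    (fun r => C * ‖deriv Real.smoothTransition r‖) (fun n => ?_) ?_ (fun n => ?_) ?_
  · exact ((hu.comp (by fun_prop)).mul
      continuous_deriv_smoothTransition).aestronglyMeasurable
  · exact (continuous_deriv_smoothTransition.integrable_of_hasCompactSupport
      hasCompactSupport_deriv_smoothTransition).norm.const_mul C
  · refine .of_forall fun r => ?_
    rw [norm_mul]
    by_cases hr : r ∈ Icc (0 : ℝ) 1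
    · refine mul_le_mul_of_nonneg_right (hC _ ⟨?_, ?_⟩) (norm_nonneg _)
      · have : 0 ≤ r / ((n : ℝ) + 1) := div_nonneg hr.1 (by positivity)
        linarith
      · have : r / ((n : ℝ) + 1) ≤ 1 := by
          rw [div_le_one (by positivity)]
          have : (0 : ℝ) ≤ n := by positivity
          linarith [hr.2]
        linarith
    · rw [deriv_smoothTransition_eq_zero hr]
      simp
  · refine .of_forall fun r => ?_
    refine Tendsto.mul_const _ ((hu.tendsto c).comp ?_)
    have h := (tendsto_const_div_atTop_nhds_zero_nat r).comp (tendsto_add_atTop_nat 1)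
    simpa using h.const_add c

theorem deriv_plateau (k c d t : ℝ) : deriv (plateau k c d) t =
    k * deriv Real.smoothTransition (k * (t - c)) -
      k * deriv Real.smoothTransition (k * (t - d)) := by
  have h : ∀ e : ℝ, HasDerivAt (fun t => Real.smoothTransition (k * (t - e)))
      (k * deriv Real.smoothTransition (k * (t - e))) t := fun e => by
    have h1 : HasDerivAt (fun t => k * (t - e)) k t := by
      simpa using ((hasDerivAt_id t).sub_const e).const_mul k
    have := (differentiable_smoothTransition (k * (t - e))).hasDerivAt.comp t h1
    rwa [mul_comm] at this
  exact ((h c).sub (h d)).deriv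

/-- The derivative of a plateau is an approximate identity at `c` minus one at `d`. -/
theorem tendsto_integral_mul_deriv_plateau {u : ℝ → ℝ} (hu : Continuous u) (c d : ℝ) :
    Tendsto (fun n : ℕ => ∫ t, u t * deriv (plateau ((n : ℝ) + 1) c d) t) atTop
      (𝓝 (u c - u d)) := by
  have hint : ∀ (n : ℕ) (e : ℝ), Integrable fun t => u t *
      (((n : ℝ) + 1) * deriv Real.smoothTransition (((n : ℝ) + 1) * (t - e))) := by
    intro n e
    have hk : (0 : ℝ) < n + 1 := by positivity
    refine Continuous.integrable_of_hasCompactSupport (hu.mul (continuous_const.mul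
      (continuous_deriv_smoothTransition.comp (by fun_prop)))) ?_
    refine HasCompactSupport.intro (isCompact_Icc (a := e) (b := e + 1)) fun t ht => ?_
    rw [deriv_smoothTransition_eq_zero, mul_zero, mul_zero]
    contrapose! ht
    have h0 : (0 : ℝ) ≤ n := by positivity
    constructor
    · nlinarith [ht.1]
    · nlinarith [ht.2, ht.1]
  refine ((tendsto_integral_mul_deriv_smoothTransition hu c).sub
    (tendsto_integral_mul_deriv_smoothTransition hu d)).congr fun n => ?_
  rw [← integral_sub (hint n c) (hint n d)]
  congr 1 with t
  rw [deriv_plateau, mul_sub (u t)]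

/-- The plateaus tend pointwise to the indicator of `(c, d]`, are bounded by 1 and vanish off `[c, d
+ 1]`, so `‖g‖` on that interval dominates. -/
theorem tendsto_integral_mul_plateau {g : ℝ → ℝ} (hg : LocallyIntegrable g) {c d : ℝ}
    (hcd : c ≤ d) :
    Tendsto (fun n : ℕ => ∫ t, g t * plateau ((n : ℝ) + 1) c d t) atTop
      (𝓝 (∫ t in c..d, g t)) := by
  rw [intervalIntegral.integral_of_le hcd, ← integral_indicator measurableSet_Ioc]
  have hstep : ∀ e t : ℝ, Tendsto (fun n : ℕ => Real.smoothTransition (((n : ℝ) + 1) * (t - e)))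
      atTop (𝓝 (if e < t then 1 else 0)) := by
    intro e t
    split_ifs with h
    · refine tendsto_const_nhds.congr' ?_
      obtain ⟨m, hm⟩ := exists_nat_gt (1 / (t - e))
      filter_upwards [eventually_ge_atTop m] with n hn
      rw [Real.smoothTransition.one_of_one_le]
      have h1 : 1 / (t - e) ≤ (n : ℝ) + 1 := by
        have : (m : ℝ) ≤ n := by exact_mod_cast hn
        linarith
      rwa [div_le_iff₀ (sub_pos.2 h)] at h1
    · refine tendsto_const_nhds.congr fun n => ?_
      rw [Real.smoothTransition.zero_of_nonpos]
      exact mul_nonpos_of_nonneg_of_nonpos (by positivity) (by linarith)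
  refine tendsto_integral_of_dominated_convergence ((Icc c (d + 1)).indicator fun t => ‖g t‖)
    (fun n => ?_) ?_ (fun n => ?_) ?_
  · exact hg.aestronglyMeasurable.mul (contDiff_plateau _ c d).continuous.aestronglyMeasurable
  · exact (integrable_indicator_iff measurableSet_Icc).2
      (hg.integrableOn_isCompact isCompact_Icc).norm
  · refine .of_forall fun t => ?_
    have hk : (0 : ℝ) < n + 1 := by positivity
    by_cases ht : t ∈ Icc c (d + 1)
    · rw [indicator_of_mem ht, norm_mul]
      exact mul_le_of_le_one_right (norm_nonneg _) (abs_plateau_le_one _ _ _ _)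
    · rw [indicator_of_notMem ht, image_eq_zero_of_notMem_tsupport (f := plateau _ c d), mul_zero, norm_zero]
      intro h
      have h' := tsupport_plateau_subset hk hcd h
      refine ht ⟨h'.1, h'.2.trans ?_⟩
      gcongr
      rw [div_le_one hk]
      simp
  · refine .of_forall fun t => ?_
    have h := ((hstep c t).sub (hstep d t)).const_mul (g t)
    have he : (Ioc c d).indicator g t =
        g t * ((if c < t then 1 else 0) - if d < t then 1 else 0) := by
      by_cases h1 : c < t <;> by_cases h2 : d < t
      · simp [h1, h2]
      · simp [h1, h2, not_lt.1 h2]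
      · exact absurd (hcd.trans_lt h2) h1
      · simp [h1, h2]
    rw [he]
    exact h

/-- The fundamental theorem of calculus for weak derivatives on the line, with plateau functions
as the only test functions. -/
theorem sub_eq_integral_of_forall_plateau {u g : ℝ → ℝ} (hu : Continuous u)
    (hg : LocallyIntegrable g) {c d : ℝ} (hcd : c ≤ d)
    (h : ∀ᶠ n : ℕ in atTop, ∫ t, u t * deriv (plateau ((n : ℝ) + 1) c d) t =
      - ∫ t, g t * plateau ((n : ℝ) + 1) c d t) :
    u d - u c = ∫ t in c..d, g t := by
  have h1 := tendsto_integral_mul_deriv_plateau hu c d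
  have h2 := (tendsto_integral_mul_plateau hg hcd).neg
  have := tendsto_nhds_unique (h1.congr' h) h2
  linarith

/-! ### Slicing weak derivatives in a product `W × ℝ` -/

section Product

variable {W : Type*} [NormedAddCommGroup W] [NormedSpace ℝ W] [FiniteDimensional ℝ W]
  [MeasurableSpace W] [BorelSpace W] {μ : Measure W} [IsLocallyFiniteMeasure μ]

theorem locallyIntegrable_real_of_forall_nat {f : ℝ → ℝ}
    (h : ∀ n : ℕ, IntegrableOn f (Icc (-(n : ℝ)) n)) : LocallyIntegrable f := by
  intro x
  obtain ⟨n, hn⟩ := exists_nat_gt |x|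
  rw [abs_lt] at hn
  exact ⟨Icc (-(n : ℝ)) n, Icc_mem_nhds hn.1 hn.2, h n⟩

/-- Here `w` cuts off only the line variable and `C` the transverse one. Fubini then makes `y ↦ ∫ t,
u (y, t) * w t` locally integrable. -/
theorem integrable_restrict_prod_of_mul_snd {u : W × ℝ → ℝ}
    (hu : LocallyIntegrable u (μ.prod volume)) {w : ℝ → ℝ} (hw : Continuous w)
    (hwc : HasCompactSupport w) {C : Set W} (hC : IsCompact C) :
    Integrable (fun z : W × ℝ => u z * w z.2) ((μ.restrict C).prod volume) := by
  have h1 : IntegrableOn (fun z : W × ℝ => u z * w z.2) (C ×ˢ tsupport w) (μ.prod volume) :=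
    (hu.integrableOn_isCompact (hC.prod hwc)).mul_continuousOn
      (hw.comp continuous_snd).continuousOn (hC.prod hwc)
  have h2 : IntegrableOn (fun z : W × ℝ => u z * w z.2) (univ ×ˢ tsupport w)
      ((μ.restrict C).prod volume) := by
    rwa [IntegrableOn, ← Measure.prod_restrict, Measure.restrict_univ, Measure.prod_restrict]
  refine h2.integrable_of_forall_notMem_eq_zero fun z hz => ?_
  rw [image_eq_zero_of_notMem_tsupport (f := w), mul_zero]
  exact fun h => hz ⟨mem_univ _, h⟩

/-- Almost every slice of a locally integrable function is locally integrable. -/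
theorem ae_locallyIntegrable_slice {g : W × ℝ → ℝ} (hg : LocallyIntegrable g (μ.prod volume)) :
    ∀ᵐ y ∂μ, LocallyIntegrable fun t => g (y, t) := by
  have h : ∀ m n : ℕ, ∀ᵐ y ∂μ, y ∈ compactCovering W m →
      IntegrableOn (fun t => g (y, t)) (Icc (-(n : ℝ)) n) := by
    intro m n
    have h1 := hg.integrableOn_isCompact
      ((isCompact_compactCovering W m).prod (isCompact_Icc (a := -(n : ℝ)) (b := n)))
    rw [IntegrableOn, ← Measure.prod_restrict] at h1
    exact (ae_restrict_iff' (isCompact_compactCovering W m).measurableSet).1 h1.prod_right_ae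
  filter_upwards [ae_all_iff.2 fun m => ae_all_iff.2 fun n => h m n] with y hy
  obtain ⟨m, hm⟩ := mem_iUnion.1 ((iUnion_compactCovering W).symm ▸ mem_univ y)
  exact locallyIntegrable_real_of_forall_nat fun n => hy m n hm

/-- Testing against tensor products localizes to almost every line. -/
theorem ae_slice_integral_eq {u g : W × ℝ → ℝ} (hu : LocallyIntegrable u (μ.prod volume))
    (hg : LocallyIntegrable g (μ.prod volume)) {V : Set W} (hV : IsOpen V) {ψ : ℝ → ℝ}
    (hψ : ContDiff ℝ ∞ ψ) (hψc : HasCompactSupport ψ)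
    (h : ∀ χ : W → ℝ, ContDiff ℝ ∞ χ → HasCompactSupport χ → tsupport χ ⊆ V →
      ∫ z : W × ℝ, u z * (χ z.1 * deriv ψ z.2) ∂μ.prod volume =
        - ∫ z : W × ℝ, g z * (χ z.1 * ψ z.2) ∂μ.prod volume) :
    ∀ᵐ y ∂μ, y ∈ V → ∫ t, u (y, t) * deriv ψ t = - ∫ t, g (y, t) * ψ t := by
  have hψ' : Continuous (deriv ψ) := hψ.continuous_deriv (by simp)
  have hloc : ∀ {u : W × ℝ → ℝ} {w : ℝ → ℝ}, LocallyIntegrable u (μ.prod volume) →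
      Continuous w → HasCompactSupport w →
      LocallyIntegrable (fun y => ∫ t, u (y, t) * w t) μ := fun hu hw hwc =>
    locallyIntegrable_iff.2 fun C hC =>
      (integrable_restrict_prod_of_mul_snd hu hw hwc hC).integral_prod_left
  have htest : ∀ {u : W × ℝ → ℝ} {w : ℝ → ℝ} {χ : W → ℝ}, LocallyIntegrable u (μ.prod volume) →
      Continuous w → HasCompactSupport w → Continuous χ → HasCompactSupport χ →
      Integrable (fun y => χ y * (∫ t, u (y, t) * w t)) μ ∧
      ∫ z : W × ℝ, u z * (χ z.1 * w z.2) ∂μ.prod volume =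
        ∫ y, χ y * (∫ t, u (y, t) * w t) ∂μ := by
    intro u w χ hu hw hwc hχ hχc
    have hi : Integrable (fun z : W × ℝ => u z * (χ z.1 * w z.2)) (μ.prod volume) := by
      have hc : HasCompactSupport fun z : W × ℝ => χ z.1 * w z.2 := by
        refine HasCompactSupport.intro (hχc.prod hwc) fun z hz => ?_
        rw [mem_prod, not_and_or] at hz
        rcases hz with hz | hz
        · rw [image_eq_zero_of_notMem_tsupport hz, zero_mul]
        · rw [image_eq_zero_of_notMem_tsupport hz, mul_zero]
      have := hu.integrable_smul_right_of_hasCompactSupport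
        ((hχ.comp continuous_fst).mul (hw.comp continuous_snd)) hc
      simpa using this
    constructor
    · have := (hloc hu hw hwc).integrable_smul_left_of_hasCompactSupport hχ hχc
      simpa using this
    · rw [integral_prod _ hi]
      congr 1 with y
      rw [← integral_const_mul]
      congr 1 with t
      ring
  -- By Fubini, the tensor identities say that the sum of the two slice integrals is orthogonal to
  -- every test function `χ` on `V`.
  have hzero := hV.ae_eq_zero_of_integral_contDiff_smul_eq_zero
    (((hloc hu hψ' hψc.deriv).add (hloc hg hψ.continuous hψc)).locallyIntegrableOn V)
    fun χ hχ hχc hχV => by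
      have h1 := htest hu hψ' hψc.deriv hχ.continuous hχc
      have h2 := htest hg hψ.continuous hψc hχ.continuous hχc
      have h3 := h χ hχ hχc hχV
      rw [h1.2, h2.2] at h3
      simp only [Pi.add_apply, smul_eq_mul, mul_add]
      rw [integral_add h1.1 h2.1, h3, neg_add_cancel]
  filter_upwards [hzero] with y hy hyV
  exact eq_neg_of_add_eq_zero_left (hy hyV)

/-- On almost every line on which it is continuous, a function with weak directional derivative
`g` in an open set differs from a primitive of `g` by a locally constant function. -/
theorem ae_slice_sub_primitive_locally_const {u g : W × ℝ → ℝ} {Ω : Set (W × ℝ)} (hΩ : IsOpen Ω)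
    (hu : LocallyIntegrable u (μ.prod volume)) (hg : LocallyIntegrable g (μ.prod volume))
    (h : ∀ (χ : W → ℝ) (ψ : ℝ → ℝ), ContDiff ℝ ∞ χ → HasCompactSupport χ →
      ContDiff ℝ ∞ ψ → HasCompactSupport ψ → tsupport χ ×ˢ tsupport ψ ⊆ Ω →
      ∫ z : W × ℝ, u z * (χ z.1 * deriv ψ z.2) ∂μ.prod volume =
        - ∫ z : W × ℝ, g z * (χ z.1 * ψ z.2) ∂μ.prod volume) :
    ∀ᵐ y ∂μ, Continuous (fun t => u (y, t)) → ∀ t, (y, t) ∈ Ω →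
      ∀ᶠ s in 𝓝 t, u (y, s) - ∫ r in (0 : ℝ)..s, g (y, r) =
        u (y, t) - ∫ r in (0 : ℝ)..t, g (y, r) := by
  -- Basis sets, rational endpoints and integer steepnesses are countably many, so one null set of
  -- lines serves for all of them.
  have hall : ∀ᵐ y ∂μ, ∀ V ∈ TopologicalSpace.countableBasis W, ∀ (c d : ℚ) (n : ℕ), c ≤ d →
      V ×ˢ Icc (c : ℝ) (d + 1 / ((n : ℝ) + 1)) ⊆ Ω → y ∈ V →
      ∫ t, u (y, t) * deriv (plateau ((n : ℝ) + 1) c d) t =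
        - ∫ t, g (y, t) * plateau ((n : ℝ) + 1) c d t := by
    rw [ae_ball_iff (TopologicalSpace.countable_countableBasis W)]
    intro V hV
    simp only [ae_all_iff]
    intro c d n hcd hsub
    have hk : (0 : ℝ) < n + 1 := by positivity
    have hcd' : (c : ℝ) ≤ d := by exact_mod_cast hcd
    refine ae_slice_integral_eq hu hg (TopologicalSpace.isOpen_of_mem_countableBasis hV)
      (contDiff_plateau _ _ _) (hasCompactSupport_plateau hk hcd') fun χ hχ hχc hχV => ?_
    exact h χ _ hχ hχc (contDiff_plateau _ _ _) (hasCompactSupport_plateau hk hcd')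
      ((prod_mono hχV (tsupport_plateau_subset hk hcd')).trans hsub)
  filter_upwards [hall, ae_locallyIntegrable_slice hg] with y hy hgy huy t ht
  obtain ⟨V', I, hV', hyV', hI, htI, hVI⟩ := mem_nhds_prod_iff'.1 (hΩ.mem_nhds ht)
  obtain ⟨V, hVB, hyV, hVV'⟩ :=
    (TopologicalSpace.isBasis_countableBasis W).exists_subset_of_mem_open hyV' hV'
  obtain ⟨ε, hε, hεI⟩ := Metric.isOpen_iff.1 hI t htI
  rw [Real.ball_eq_Ioo] at hεI
  set F : ℝ → ℝ := fun s => u (y, s) - ∫ r in (0 : ℝ)..s, g (y, r) with hF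
  have hint : ∀ a b : ℝ, IntervalIntegrable (fun r => g (y, r)) volume a b := fun a b =>
    (hgy.integrableOn_isCompact isCompact_uIcc).intervalIntegrable
  have hFc : Continuous F := huy.sub (intervalIntegral.continuous_primitive hint 0)
  have hrat : ∀ c d : ℚ, c ≤ d → (c : ℝ) ∈ Ioo (t - ε) (t + ε) → (d : ℝ) ∈ Ioo (t - ε) (t + ε) →
      F c = F d := by
    intro c d hcd hc hd
    -- A plateau extends `1 / (n + 1)` beyond `d`; for large `n` this tail stays inside the box
    -- contained in `Ω`.
    have hev : ∀ᶠ n : ℕ in atTop, 1 / ((n : ℝ) + 1) < t + ε - d :=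
      tendsto_one_div_add_atTop_nhds_zero_nat.eventually_lt_const (by linarith [hd.2])
    have := sub_eq_integral_of_forall_plateau huy hgy (c := c) (d := d) (by exact_mod_cast hcd) (by
      filter_upwards [hev] with n hn
      refine hy V hVB c d n hcd ?_ hyV
      refine (prod_mono hVV' fun x hx => hεI ⟨hc.1.trans_le hx.1, ?_⟩).trans hVI
      linarith [hx.2])
    have h2 := intervalIntegral.integral_add_adjacent_intervals (hint 0 c) (hint c d)
    simp only [hF]
    linarith
  obtain ⟨q, hq⟩ := exists_rat_btwn (show t - ε < t + ε by linarith)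
  have hconst : ∀ s ∈ Ioo (t - ε) (t + ε), F s = F q := by
    intro s hs
    have hcl := Rat.denseRange_cast.open_subset_closure_inter isOpen_Ioo hs
    refine closure_minimal (t := {s | F s = F q}) ?_ (isClosed_eq hFc continuous_const) hcl
    rintro _ ⟨hr, r, rfl⟩
    rcases le_total r q with hrq | hrq
    · exact hrat r q hrq hr hq
    · exact (hrat q r hrq hq hr).symm
  filter_upwards [Ioo_mem_nhds (show t - ε < t by linarith) (show t < t + ε by linarith)] with s hs
  exact (hconst s hs).trans (hconst t ⟨by linarith, by linarith⟩).symm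

/-- Countable sections of the complement of `Ω` are invisible to the weak derivative along almost
every line on which the function is continuous. -/
theorem ae_slice_integral_eq_of_countable {u g : W × ℝ → ℝ} {Ω : Set (W × ℝ)} (hΩ : IsOpen Ω)
    (hu : LocallyIntegrable u (μ.prod volume)) (hg : LocallyIntegrable g (μ.prod volume))
    (huc : ∀ᵐ y ∂μ, Continuous fun t => u (y, t))
    (h : ∀ (χ : W → ℝ) (ψ : ℝ → ℝ), ContDiff ℝ ∞ χ → HasCompactSupport χ →
      ContDiff ℝ ∞ ψ → HasCompactSupport ψ → tsupport χ ×ˢ tsupport ψ ⊆ Ω →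
      ∫ z : W × ℝ, u z * (χ z.1 * deriv ψ z.2) ∂μ.prod volume =
        - ∫ z : W × ℝ, g z * (χ z.1 * ψ z.2) ∂μ.prod volume) :
    ∀ᵐ y ∂μ, {t | (y, t) ∉ Ω}.Countable → ∀ ψ : ℝ → ℝ, ContDiff ℝ ∞ ψ → HasCompactSupport ψ →
      ∫ t, u (y, t) * deriv ψ t = - ∫ t, g (y, t) * ψ t := by
  filter_upwards [ae_slice_sub_primitive_locally_const hΩ hu hg h, huc,
    ae_locallyIntegrable_slice hg] with y hy huy hgy hcount ψ hψ hψc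
  have hFc : Continuous fun s => u (y, s) - ∫ r in (0 : ℝ)..s, g (y, r) :=
    huy.sub (intervalIntegral.continuous_primitive (fun a b =>
      (hgy.integrableOn_isCompact isCompact_uIcc).intervalIntegrable) 0)
  have hconst := eq_of_eventually_eq_off_countable hFc hcount
    fun t ht => hy huy t (not_not.1 ht)
  refine integral_mul_deriv_of_eq_integral hgy (C := u (y, 0)) (fun t => ?_) hψ hψc
  have := hconst t 0
  simp only [intervalIntegral.integral_same, sub_zero] at this
  linarith

end Product

/-! ### Orthogonal coordinates along a direction -/

section Line

variable {E : Type*} [NormedAddCommGroup E] [InnerProductSpace ℝ E]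

/-- Orthogonal coordinates adapted to the lines parallel to a unit vector `v`. -/
def lineEquiv (v : E) (hv : ‖v‖ = 1) :
    (((Submodule.span ℝ {v})ᗮ : Submodule ℝ E) × ℝ) ≃L[ℝ] E :=
  (ContinuousLinearEquiv.prodComm ℝ _ ℝ).trans
    ((WithLp.prodContinuousLinearEquiv 2 ℝ ℝ _).symm.trans
      ((LinearIsometryEquiv.withLpProdCongr 2
        (LinearIsometryEquiv.toSpanUnitSingleton v hv)
        (LinearIsometryEquiv.refl ℝ ((Submodule.span ℝ {v})ᗮ : Submodule ℝ E))).trans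
        (Submodule.span ℝ {v}).orthogonalDecomposition.symm).toContinuousLinearEquiv)

theorem lineEquiv_apply (v : E) (hv : ‖v‖ = 1)
    (z : ((Submodule.span ℝ {v})ᗮ : Submodule ℝ E) × ℝ) :
    lineEquiv v hv z = (z.1 : E) + z.2 • v := by
  simp [lineEquiv, add_comm]

/-- The map is a swap, the volume-preserving passage to the `L²` product, and then a linear
isometry; `‖v‖ = 1` makes the last an isometry. -/
theorem measurePreserving_lineEquiv [FiniteDimensional ℝ E] [MeasurableSpace E] [BorelSpace E]
    (v : E) (hv : ‖v‖ = 1) :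
    MeasurePreserving (lineEquiv v hv) (volume.prod volume) volume := by
  have h1 := (LinearIsometryEquiv.withLpProdCongr 2
        (LinearIsometryEquiv.toSpanUnitSingleton v hv)
        (LinearIsometryEquiv.refl ℝ ((Submodule.span ℝ {v})ᗮ : Submodule ℝ E))).trans
        (Submodule.span ℝ {v}).orthogonalDecomposition.symm |>.measurePreserving
  have h2 := WithLp.volume_preserving_toLp ℝ ((Submodule.span ℝ {v})ᗮ : Submodule ℝ E)
  exact h1.comp (h2.comp Measure.measurePreserving_swap)

end Line

/-! ### Capacity controls projections along an axis -/

/-- A `C^1` function on the line that is at least one somewhere has large Sobolev norm. -/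
theorem one_le_lintegral_rpow {p : ℝ} (hp : 1 ≤ p) {f : ℝ → ℝ} (hf : ContDiff ℝ 1 f) {t₀ : ℝ}
    (h : 1 ≤ f t₀) : 1 ≤ ∫⁻ t, ‖|f t| + |deriv f t|‖ₑ ^ p := by
  -- Unit length makes the restricted measure a probability, so the `L¹` norm is bounded by the
  -- `L^p` norm with constant 1.
  set I := Ioc t₀ (t₀ + 1)
  have hfc : Continuous f := hf.continuous
  have : IsProbabilityMeasure (volume.restrict I) := ⟨by simp [I]⟩
  have hd : Continuous (deriv f) := hf.continuous_deriv le_rfl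
  have hw : Continuous fun t => |f t| + |deriv f t| := hf.continuous.abs.add hd.abs
  have hpt : ∀ s ∈ I, 1 ≤ ‖f s‖ₑ + ∫⁻ t in I, ‖deriv f t‖ₑ := by
    intro s hs
    have h1 : f s - f t₀ = ∫ t in t₀..s, deriv f t :=
      (intervalIntegral.integral_deriv_eq_sub (fun x _ => (hf.differentiable (by simp)) x)
        (hd.intervalIntegrable _ _)).symm
    have h2 : ‖f s - f t₀‖ₑ ≤ ∫⁻ t in I, ‖deriv f t‖ₑ := by
      rw [h1, intervalIntegral.integral_of_le hs.1.le]
      exact (enorm_integral_le_lintegral_enorm _).trans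
        (lintegral_mono_set (Ioc_subset_Ioc_right hs.2))
    calc (1 : ℝ≥0∞) = ENNReal.ofReal 1 := by simp
      _ ≤ ‖f t₀‖ₑ := by
        rw [Real.enorm_eq_ofReal_abs]
        exact ENNReal.ofReal_le_ofReal (h.trans (le_abs_self _))
      _ = ‖f s - (f s - f t₀)‖ₑ := by rw [sub_sub_cancel]
      _ ≤ ‖f s‖ₑ + ‖f s - f t₀‖ₑ := enorm_sub_le
      _ ≤ _ := by gcongr
  have h1 : 1 ≤ eLpNorm (fun t => |f t| + |deriv f t|) 1 (volume.restrict I) := by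
    rw [eLpNorm_one_eq_lintegral_enorm]
    calc (1 : ℝ≥0∞) = ∫⁻ s in I, 1 := by simp [I]
      _ ≤ ∫⁻ s in I, (‖f s‖ₑ + ∫⁻ t in I, ‖deriv f t‖ₑ) :=
        setLIntegral_mono (by fun_prop) hpt
      _ = (∫⁻ s in I, ‖f s‖ₑ) + ∫⁻ t in I, ‖deriv f t‖ₑ := by
        rw [lintegral_add_right _ (by fun_prop)]
        simp [I]
      _ = ∫⁻ s in I, (‖f s‖ₑ + ‖deriv f s‖ₑ) := by
        rw [lintegral_add_right _ (by fun_prop)]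
      _ = _ := by
        congr 1 with s
        rw [Real.enorm_eq_ofReal_abs, Real.enorm_eq_ofReal_abs, Real.enorm_eq_ofReal_abs,
          ← ENNReal.ofReal_add (abs_nonneg _) (abs_nonneg _), abs_of_nonneg (add_nonneg (abs_nonneg (f s)) (abs_nonneg (deriv f s)))]
  have hp0 : 0 < p := by linarith
  have h2 := h1.trans (eLpNorm_le_eLpNorm_of_exponent_le (q := ENNReal.ofReal p)
    (by rwa [ENNReal.one_le_ofReal]) hw.aestronglyMeasurable)
  rw [eLpNorm_eq_lintegral_rpow_enorm_toReal (by simpa using hp0) ENNReal.ofReal_ne_top,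
    ENNReal.toReal_ofReal hp0.le] at h2
  have h3 := ENNReal.rpow_le_rpow h2 hp0.le
  rw [ENNReal.one_rpow, ← ENNReal.rpow_mul, one_div_mul_cancel hp0.ne', ENNReal.rpow_one] at h3
  exact h3.trans (setLIntegral_le_lintegral _ _)

section Capacity

variable {N : ℕ} {p : ℝ} (j : Fin N)

/-- Orthogonal coordinates adapted to the lines parallel to the `j`-th axis. -/
abbrev axisEquiv (j : Fin N) :
    (((Submodule.span ℝ {EuclideanSpace.single j (1 : ℝ)})ᗮ :
      Submodule ℝ (EuclideanSpace ℝ (Fin N))) × ℝ) ≃L[ℝ] EuclideanSpace ℝ (Fin N) :=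
  lineEquiv (EuclideanSpace.single j (1 : ℝ)) (by simp)

theorem measurePreserving_axisEquiv :
    MeasurePreserving (axisEquiv j) (volume.prod volume) volume :=
  measurePreserving_lineEquiv _ _

theorem deriv_comp_axisEquiv {φ : EuclideanSpace ℝ (Fin N) → ℝ} (hφ : ContDiff ℝ ∞ φ)
    (y : ((Submodule.span ℝ {EuclideanSpace.single j (1 : ℝ)})ᗮ :
      Submodule ℝ (EuclideanSpace ℝ (Fin N)))) (t : ℝ) :
    deriv (fun s => φ (axisEquiv j (y, s))) t = partialDeriv j φ (axisEquiv j (y, t)) := by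
  have h1 : HasDerivAt (fun s => axisEquiv j (y, s)) (EuclideanSpace.single j (1 : ℝ)) t := by
    simp only [lineEquiv_apply]
    simpa using ((hasDerivAt_id t).smul_const (EuclideanSpace.single j (1 : ℝ))).const_add
      (y : EuclideanSpace ℝ (Fin N))
  exact ((hφ.differentiable (by simp) _).hasFDerivAt.comp_hasDerivAt t h1).deriv

theorem continuous_partialDeriv {φ : EuclideanSpace ℝ (Fin N) → ℝ} (hφ : ContDiff ℝ ∞ φ) :
    Continuous (partialDeriv j φ) :=
  (hφ.continuous_fderiv (by simp)).clm_apply continuous_const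

theorem contDiff_axisEquiv_slice {φ : EuclideanSpace ℝ (Fin N) → ℝ} (hφ : ContDiff ℝ ∞ φ)
    (y : ((Submodule.span ℝ {EuclideanSpace.single j (1 : ℝ)})ᗮ :
      Submodule ℝ (EuclideanSpace ℝ (Fin N)))) :
    ContDiff ℝ ∞ fun s => φ (axisEquiv j (y, s)) :=
  hφ.comp ((axisEquiv j).contDiff.comp (contDiff_prodMk_right y))

/-- The measure of the projection of a compact set along an axis is controlled by its capacity. -/
theorem volume_projection_le_capCompact (hp : 1 ≤ p) (F : Set (EuclideanSpace ℝ (Fin N))) :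
    volume {y | ∃ t : ℝ, axisEquiv j (y, t) ∈ F} ≤ capCompact p F ^ p := by
  have hp0 : 0 < p := by linarith
  rw [← ENNReal.rpow_inv_le_iff hp0]
  refine le_iInf fun φ => le_iInf fun hφ => le_iInf fun hφc => le_iInf fun hF => ?_
  rw [ENNReal.rpow_inv_le_iff hp0]
  set w : EuclideanSpace ℝ (Fin N) → ℝ := fun x => |φ x| + |partialDeriv j φ x| with hw
  have hwc : Continuous w := hφ.continuous.abs.add (continuous_partialDeriv j hφ).abs
  have h1 : eLpNorm w (ENNReal.ofReal p) volume ≤ eLpNorm φ (ENNReal.ofReal p) volume +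
      ∑ j : Fin N, eLpNorm (partialDeriv j φ) (ENNReal.ofReal p) volume := by
    refine (eLpNorm_add_le (f := fun x => ‖φ x‖) (g := fun x => ‖partialDeriv j φ x‖)
      hφ.continuous.norm.aestronglyMeasurable
      (continuous_partialDeriv j hφ).norm.aestronglyMeasurable
      (by rwa [ENNReal.one_le_ofReal])).trans ?_
    rw [eLpNorm_norm, eLpNorm_norm]
    gcongr
    exact Finset.single_le_sum (f := fun j => eLpNorm (partialDeriv j φ) (ENNReal.ofReal p) volume)
      (fun _ _ => zero_le) (Finset.mem_univ j)
  refine le_trans ?_ (ENNReal.rpow_le_rpow h1 hp0.le)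
  rw [eLpNorm_eq_lintegral_rpow_enorm_toReal (by simpa using hp0) ENNReal.ofReal_ne_top,
    ENNReal.toReal_ofReal hp0.le, ← ENNReal.rpow_mul, one_div_mul_cancel hp0.ne', ENNReal.rpow_one]
  have hm : Measurable fun x => ‖w x‖ₑ ^ p := hwc.enorm.measurable.pow_const p
  have hm' : Measurable fun z => ‖w (axisEquiv j z)‖ₑ ^ p :=
    hm.comp (axisEquiv j).continuous.measurable
  rw [← (measurePreserving_axisEquiv j).lintegral_comp hm, lintegral_prod _ hm'.aemeasurable]
  -- Markov's inequality at level 1: by `one_le_lintegral_rpow`, every line meeting `F` carries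
  -- energy at least 1.
  have hmar := mul_meas_ge_le_lintegral (μ := volume)
    (Measurable.lintegral_prod_right' (ν := volume) hm') 1
  rw [one_mul] at hmar
  refine (measure_mono ?_).trans hmar
  rintro y ⟨t, ht⟩
  have := one_le_lintegral_rpow hp ((contDiff_axisEquiv_slice j hφ y).of_le (by simp)) (hF _ ht)
  simp only [deriv_comp_axisEquiv j hφ] at this
  exact this

/-- An open set is an increasing union of compact sets, its projections increase with them, and
measure is continuous from below. -/
theorem volume_projection_le_capOpen (hp : 1 ≤ p) {U : Set (EuclideanSpace ℝ (Fin N))}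
    (hU : IsOpen U) : volume {y | ∃ t : ℝ, axisEquiv j (y, t) ∈ U} ≤ capOpen p U ^ p := by
  obtain ⟨F, hFc, hFU, hF, hFm⟩ := hU.exists_iUnion_isClosed
  have hunion : {y | ∃ t : ℝ, axisEquiv j (y, t) ∈ U} =
      ⋃ n : ℕ, {y | ∃ t : ℝ, axisEquiv j (y, t) ∈ F n ∩ Metric.closedBall 0 n} := by
    ext y
    simp only [mem_ofPred_eq, mem_iUnion]
    constructor
    · rintro ⟨t, ht⟩
      rw [← hF] at ht
      obtain ⟨n, hn⟩ := mem_iUnion.1 ht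
      obtain ⟨m, hm⟩ := exists_nat_ge ‖axisEquiv j (y, t)‖
      refine ⟨max n m, t, hFm (le_max_left n m) hn, mem_closedBall_zero_iff.2 (hm.trans ?_)⟩
      exact_mod_cast le_max_right n m
    · rintro ⟨n, t, ht, -⟩
      exact ⟨t, hFU n ht⟩
  have hmono : Monotone fun n : ℕ =>
      {y | ∃ t : ℝ, axisEquiv j (y, t) ∈ F n ∩ Metric.closedBall 0 n} := by
    rintro m n hmn y ⟨t, h1, h2⟩
    exact ⟨t, hFm hmn h1, Metric.closedBall_subset_closedBall (by exact_mod_cast hmn) h2⟩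
  rw [hunion, hmono.measure_iUnion]
  refine iSup_le fun n => (volume_projection_le_capCompact j hp _).trans ?_
  refine ENNReal.rpow_le_rpow ?_ (by linarith)
  exact le_iSup_of_le _ (le_iSup_of_le ((isCompact_closedBall 0 (n : ℝ)).inter_left (hFc n))
    (le_iSup_of_le (inter_subset_left.trans (hFU n)) le_rfl))

/-- A quasicontinuous function is continuous on almost every line parallel to an axis. -/
theorem ae_continuous_slice_of_quasicontinuous (hp : 1 ≤ p)
    {u : EuclideanSpace ℝ (Fin N) → ℝ} (hu : u ∈ quasicontinuous N p) :
    ∀ᵐ y, Continuous fun t : ℝ => u (axisEquiv j (y, t)) := by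
  rw [ae_iff]
  -- A line missing `U` lies where `u` is continuous, so the bad lines have measure at most `1 / n`
  -- for every `n`.
  refine le_antisymm (ge_of_tendsto' ENNReal.tendsto_inv_nat_nhds_zero fun n => ?_) zero_le
  rcases Nat.eq_zero_or_pos n with rfl | hn
  · simp
  obtain ⟨U, hU, hcap, hcont⟩ := hu.2 (n : ℝ≥0∞)⁻¹ (by simp)
  have hn1 : (n : ℝ≥0∞)⁻¹ ≤ 1 := ENNReal.inv_le_one.2 (by exact_mod_cast hn)
  calc _ ≤ volume {y | ∃ t : ℝ, axisEquiv j (y, t) ∈ U} := by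
        refine measure_mono fun y hy => ?_
        by_contra hno
        refine hy (hcont.comp_continuous (by fun_prop) fun t ht => hno ⟨t, ht⟩)
    _ ≤ capOpen p U ^ p := volume_projection_le_capOpen j hp hU
    _ ≤ (n : ℝ≥0∞)⁻¹ ^ p := ENNReal.rpow_le_rpow hcap.le (by linarith)
    _ ≤ _ := ENNReal.rpow_le_self_of_le_one hn1 hp

end Capacity

/-! ### Removability of compact sets with countable sections -/

/-- `P` need not be measurable. If `S` had positive measure, discarding the exceptional null set
would leave a measurable subset of positive measure, and its point satisfying `P` would be a
contradiction. In the applications, `P y` says that the section over `y` is countable. -/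
theorem measure_eq_zero_of_ae_imp_notMem {α : Type*} [MeasurableSpace α] {μ : Measure α}
    {P : α → Prop} (hP : ∀ A, MeasurableSet A → 0 < μ A → ∃ y ∈ A, P y) {S : Set α}
    (hS : NullMeasurableSet S μ) (h : ∀ᵐ y ∂μ, P y → y ∉ S) : μ S = 0 := by
  by_contra hne
  have hae : (S ∩ {y | P y → y ∉ S} : Set α) =ᵐ[μ] S := inter_ae_eq_left_of_ae_eq_univ
    (eventuallyEq_univ.2 h)
  obtain ⟨A, hA, hAm, hAe⟩ := (hS.congr hae.symm).exists_measurable_subset_ae_eq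
  obtain ⟨y, hyA, hy⟩ := hP A hAm (by
    rw [measure_congr (hAe.trans hae)]
    exact pos_iff_ne_zero.2 hne)
  exact (hA hyA).2 hy (hA hyA).1

section Axis

variable {N : ℕ} {p : ℝ} (j : Fin N) {K : Set (EuclideanSpace ℝ (Fin N))}

theorem axisEquiv_slice_injective
    (y : ((Submodule.span ℝ {EuclideanSpace.single j (1 : ℝ)})ᗮ :
      Submodule ℝ (EuclideanSpace ℝ (Fin N)))) :
    Function.Injective fun t : ℝ => axisEquiv j (y, t) := fun a b hab => by
  simpa using (axisEquiv j).injective hab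

theorem hasCompactSupport_axisEquiv_slice {φ : EuclideanSpace ℝ (Fin N) → ℝ}
    (hφ : HasCompactSupport φ)
    (y : ((Submodule.span ℝ {EuclideanSpace.single j (1 : ℝ)})ᗮ :
      Submodule ℝ (EuclideanSpace ℝ (Fin N)))) :
    HasCompactSupport fun t : ℝ => φ (axisEquiv j (y, t)) := by
  refine HasCompactSupport.intro
    (hφ.isCompact.image (continuous_snd.comp (axisEquiv j).symm.continuous)) fun t ht => ?_
  refine image_eq_zero_of_notMem_tsupport fun h => ht ⟨_, h, ?_⟩
  simp

theorem countable_slice {y : ((Submodule.span ℝ {EuclideanSpace.single j (1 : ℝ)})ᗮ :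
      Submodule ℝ (EuclideanSpace ℝ (Fin N)))}
    (h : (K ∩ lineThrough (y : EuclideanSpace ℝ (Fin N))
      (EuclideanSpace.single j (1 : ℝ))).Countable) :
    {t : ℝ | axisEquiv j (y, t) ∈ K}.Countable := by
  have h' := h.preimage (axisEquiv_slice_injective j y)
  refine h'.mono ?_
  intro t ht
  exact ⟨ht, t, lineEquiv_apply _ _ _⟩

/-- A compact set meeting the lines of no positive family of parallels to an axis in uncountable
sets is Lebesgue null. -/
theorem volume_eq_zero_of_countable_slices (hK : IsCompact K)
    (h : ∀ A : Set ((Submodule.span ℝ {EuclideanSpace.single j (1 : ℝ)})ᗮ :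
      Submodule ℝ (EuclideanSpace ℝ (Fin N))), MeasurableSet A → 0 < volume A →
      ∃ y ∈ A, {t : ℝ | axisEquiv j (y, t) ∈ K}.Countable) : volume K = 0 := by
  have hm : MeasurableSet (axisEquiv j ⁻¹' K) :=
    (axisEquiv j).continuous.measurable hK.measurableSet
  have hm' := measurable_measure_prodMk_left (ν := (volume : Measure ℝ)) hm
  rw [← (measurePreserving_axisEquiv j).measure_preimage hK.measurableSet.nullMeasurableSet,
    Measure.measure_prod_null hm]
  refine measure_eq_zero_of_ae_imp_notMem h
    (hm' (measurableSet_singleton 0)).compl.nullMeasurableSet (.of_forall fun y hy hyS => hyS ?_)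
  exact hy.measure_zero _

theorem partialDeriv_tensor {χ : ((Submodule.span ℝ {EuclideanSpace.single j (1 : ℝ)})ᗮ :
      Submodule ℝ (EuclideanSpace ℝ (Fin N))) → ℝ} {ψ : ℝ → ℝ} (hχ : ContDiff ℝ ∞ χ)
    (hψ : ContDiff ℝ ∞ ψ)
    (z : ((Submodule.span ℝ {EuclideanSpace.single j (1 : ℝ)})ᗮ :
      Submodule ℝ (EuclideanSpace ℝ (Fin N))) × ℝ) :
    partialDeriv j (fun x => χ ((axisEquiv j).symm x).1 * ψ ((axisEquiv j).symm x).2)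
      (axisEquiv j z) = χ z.1 * deriv ψ z.2 := by
  refine (deriv_comp_axisEquiv j ((hχ.comp (contDiff_fst.comp (axisEquiv j).symm.contDiff)).mul
    (hψ.comp (contDiff_snd.comp (axisEquiv j).symm.contDiff))) z.1 z.2).symm.trans ?_
  simp only [Function.comp_apply, ContinuousLinearEquiv.symm_apply_apply]
  exact deriv_const_mul _ (hψ.differentiable (by simp) _)

/-- If a null compact set has countable sections along the `j`-th axis, a weak partial derivative
in its complement is one in the whole space, provided the function is continuous on almost every
line parallel to the axis. -/
theorem isWeakPartialDeriv_univ (hp : 1 ≤ p) (hK : IsCompact K) (hK0 : volume K = 0)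
    (h : ∀ A : Set ((Submodule.span ℝ {EuclideanSpace.single j (1 : ℝ)})ᗮ :
      Submodule ℝ (EuclideanSpace ℝ (Fin N))), MeasurableSet A → 0 < volume A →
      ∃ y ∈ A, {t : ℝ | axisEquiv j (y, t) ∈ K}.Countable)
    {u g : EuclideanSpace ℝ (Fin N) → ℝ}
    (huc : ∀ᵐ y, Continuous fun t : ℝ => u (axisEquiv j (y, t)))
    (hu : MemLp u (ENNReal.ofReal p)) (hg : MemLp g (ENNReal.ofReal p))
    (hw : IsWeakPartialDeriv Kᶜ j u g) : IsWeakPartialDeriv univ j u g := by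
  -- Since `K` is null, integrals over its complement are integrals over the whole space.
  have hres : volume.restrict Kᶜ = (volume : Measure (EuclideanSpace ℝ (Fin N))) :=
    Measure.restrict_eq_self_of_ae_mem (measure_eq_zero_iff_ae_notMem.1 hK0)
  set T := axisEquiv j with hT
  have hTm : MeasurePreserving T (volume.prod volume) volume := measurePreserving_axisEquiv j
  have hTe : MeasurableEmbedding T := T.toHomeomorph.measurableEmbedding
  have hp1 : 1 ≤ ENNReal.ofReal p := by rwa [ENNReal.one_le_ofReal]
  have hul : LocallyIntegrable (fun z => u (T z)) (volume.prod volume) :=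
    (hu.comp_measurePreserving hTm).locallyIntegrable hp1
  have hgl : LocallyIntegrable (fun z => g (T z)) (volume.prod volume) :=
    (hg.comp_measurePreserving hTm).locallyIntegrable hp1
  have htensor : ∀ (χ : ((Submodule.span ℝ {EuclideanSpace.single j (1 : ℝ)})ᗮ :
      Submodule ℝ (EuclideanSpace ℝ (Fin N))) → ℝ) (ψ : ℝ → ℝ),
      ContDiff ℝ ∞ χ → HasCompactSupport χ →
      ContDiff ℝ ∞ ψ → HasCompactSupport ψ → tsupport χ ×ˢ tsupport ψ ⊆ T ⁻¹' Kᶜ →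
      ∫ z, u (T z) * (χ z.1 * deriv ψ z.2) ∂volume.prod volume =
        - ∫ z, g (T z) * (χ z.1 * ψ z.2) ∂volume.prod volume := by
    intro χ ψ hχ hχc hψ hψc hsub
    set φ : EuclideanSpace ℝ (Fin N) → ℝ := fun x => χ (T.symm x).1 * ψ (T.symm x).2 with hφ
    have hclosed : IsCompact (T '' (tsupport χ ×ˢ tsupport ψ)) :=
      (hχc.isCompact.prod hψc.isCompact).image T.continuous
    have hsupp : tsupport φ ⊆ T '' (tsupport χ ×ˢ tsupport ψ) := by
      refine closure_minimal (fun x hx => ⟨T.symm x, ?_, T.apply_symm_apply x⟩) hclosed.isClosed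
      exact ⟨subset_tsupport _ (left_ne_zero_of_mul hx),
        subset_tsupport _ (right_ne_zero_of_mul hx)⟩
    have := hw φ ((hχ.comp (contDiff_fst.comp T.symm.contDiff)).mul
      (hψ.comp (contDiff_snd.comp T.symm.contDiff)))
      (hclosed.of_isClosed_subset (isClosed_tsupport _) hsupp)
      (hsupp.trans (image_subset_iff.2 hsub))
    rw [hres, ← hTm.integral_comp hTe, ← hTm.integral_comp hTe] at this
    simpa only [hφ, hT, partialDeriv_tensor j hχ hψ,
      ContinuousLinearEquiv.symm_apply_apply] using this
  have hae := ae_slice_integral_eq_of_countable (hK.isClosed.isOpen_compl.preimage T.continuous)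
    hul hgl huc htensor
  intro φ hφ hφc _
  have hi : ∀ {u w : EuclideanSpace ℝ (Fin N) → ℝ}, MemLp u (ENNReal.ofReal p) → Continuous w →
      HasCompactSupport w →
      Integrable (fun z => u (T z) * w (T z)) (volume.prod volume) := fun hu hw hwc => by
    have := (hu.locallyIntegrable hp1).integrable_smul_right_of_hasCompactSupport hw hwc
    simp only [smul_eq_mul] at this
    exact (hTm.integrable_comp_emb hTe).2 this
  have hdc : HasCompactSupport (partialDeriv j φ) := by
    refine hφc.fderiv (𝕜 := ℝ) |>.comp_left (g := fun L => L (EuclideanSpace.single j 1)) rfl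
  have h1 := hi hu (continuous_partialDeriv j hφ) hdc
  have h2 := hi hg hφ.continuous hφc
  -- The set where this sum is nonzero is null-measurable and almost everywhere avoids the lines
  -- with countable section, so it is null.
  have hz : (fun y => (∫ t, u (T (y, t)) * partialDeriv j φ (T (y, t))) +
      ∫ t, g (T (y, t)) * φ (T (y, t))) =ᵐ[volume] 0 := by
    have hmeas := h1.integral_prod_left.aestronglyMeasurable.aemeasurable.add
      h2.integral_prod_left.aestronglyMeasurable.aemeasurable
    refine measure_eq_zero_of_ae_imp_notMem h
      (hmeas.nullMeasurableSet_preimage (measurableSet_singleton 0)).compl ?_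
    filter_upwards [hae] with y hy hcount hyS
    refine hyS ?_
    have := hy (by simpa using hcount) _ (contDiff_axisEquiv_slice j hφ y)
      (hasCompactSupport_axisEquiv_slice j hφc y)
    simp only [deriv_comp_axisEquiv j hφ] at this
    exact add_eq_zero_iff_eq_neg.2 this
  rw [Measure.restrict_univ, ← hTm.integral_comp hTe, ← hTm.integral_comp hTe,
    integral_prod _ h1, integral_prod _ h2, ← add_eq_zero_iff_eq_neg,
    ← integral_add h1.integral_prod_left h2.integral_prod_left, integral_congr_ae hz]
  simp

end Axis

/-- A test function supported in `Ω` vanishes off `Ω` with its derivatives, so both integrals may be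
taken over the whole space. This is the trivial inclusion in both removability properties. -/
theorem sobolev_univ_subset {N : ℕ} {p : ℝ} {Ω : Set (EuclideanSpace ℝ (Fin N))} :
    sobolev p univ ⊆ sobolev p Ω := by
  rintro u ⟨hu, hg⟩
  rw [Measure.restrict_univ] at hu
  refine ⟨hu.restrict Ω, fun j => ?_⟩
  obtain ⟨g, hg, hw⟩ := hg j
  rw [Measure.restrict_univ] at hg
  refine ⟨g, hg.restrict Ω, fun φ hφ hφc hφΩ => ?_⟩
  have := hw φ hφ hφc (subset_univ _)
  rw [Measure.restrict_univ] at this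
  rw [setIntegral_eq_integral_of_forall_compl_eq_zero fun x hx => ?_,
    setIntegral_eq_integral_of_forall_compl_eq_zero fun x hx => ?_, this]
  · rw [image_eq_zero_of_notMem_tsupport (fun h => hx (hφΩ h)), mul_zero]
  · have hz : fderiv ℝ φ x = 0 :=
      image_eq_zero_of_notMem_tsupport fun h => hx (hφΩ (tsupport_fderiv_subset ℝ h))
    rw [partialDeriv, hz, zero_apply, mul_zero]

/-- Compact sets with countable sections are removable for Sobolev functions that are continuous
on almost every line parallel to an axis. -/
theorem mem_sobolev_univ_of_countable_slices {N : ℕ} (hN : 1 ≤ N) {p : ℝ} (hp : 1 ≤ p)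
    {K : Set (EuclideanSpace ℝ (Fin N))} (hK : IsCompact K)
    (h : ∀ (j : Fin N) (A : Set ((Submodule.span ℝ {EuclideanSpace.single j (1 : ℝ)})ᗮ :
      Submodule ℝ (EuclideanSpace ℝ (Fin N)))), MeasurableSet A → 0 < volume A →
      ∃ y ∈ A, {t : ℝ | axisEquiv j (y, t) ∈ K}.Countable)
    {u : EuclideanSpace ℝ (Fin N) → ℝ}
    (huc : ∀ j : Fin N, ∀ᵐ y, Continuous fun t : ℝ => u (axisEquiv j (y, t)))
    (hu : u ∈ sobolev p Kᶜ) : u ∈ sobolev p univ := by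
  -- One axis suffices for nullity, and `1 ≤ N` provides it.
  have hK0 : volume K = 0 := volume_eq_zero_of_countable_slices ⟨0, hN⟩ hK (h _)
  have hres : volume.restrict Kᶜ = (volume : Measure (EuclideanSpace ℝ (Fin N))) :=
    Measure.restrict_eq_self_of_ae_mem (measure_eq_zero_iff_ae_notMem.1 hK0)
  obtain ⟨hu, hg⟩ := hu
  rw [hres] at hu
  refine ⟨by rwa [Measure.restrict_univ], fun j => ?_⟩
  obtain ⟨g, hg, hw⟩ := hg j
  rw [hres] at hg
  exact ⟨g, by rwa [Measure.restrict_univ],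
    isWeakPartialDeriv_univ j hp hK hK0 (h j) (huc j) hu hg hw⟩

end SobolevRemovability
end

/-! ### Conclusion -/

theorem corollary1p8 :
    (∀ (N : ℕ) (_ : 1 ≤ N) (p : ℝ) (_ : 1 ≤ p) (K : Set (EuclideanSpace ℝ (Fin N)))
      (_ : IsCompact K)
      (_ : ¬ SobolevRemovability.JProperty p K ∨ ¬ SobolevRemovability.JPropertyCont p K),
      ∃ v : EuclideanSpace ℝ (Fin N), v ≠ 0 ∧
        ∃ A : Set ((Submodule.span ℝ {v})ᗮ : Submodule ℝ (EuclideanSpace ℝ (Fin N))),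
          MeasurableSet A ∧ 0 < SobolevRemovability.lineMeasure v A ∧
          ∀ y ∈ A, ¬ (K ∩ SobolevRemovability.lineThrough
            (y : EuclideanSpace ℝ (Fin N)) v).Countable) ∧
    (∀ f : ℝ → ℝ, SobolevRemovability.IsSingularFunction f →
      ¬ (SobolevRemovability.singularSupport f).Countable) := by
  refine ⟨fun N hN p hp K hK hfail => ?_,
    fun f hf => SobolevRemovability.not_countable_singularSupport hf⟩
  by_contra hno
  push Not at hno
  -- The negated conclusion is needed only for coordinate directions, where `lineMeasure` is the
  -- volume of the hyperplane.
  have hcount : ∀ (j : Fin N) (A : Set ((Submodule.span ℝ {EuclideanSpace.single j (1 : ℝ)})ᗮ :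
      Submodule ℝ (EuclideanSpace ℝ (Fin N)))), MeasurableSet A → 0 < volume A →
      ∃ y ∈ A, {t : ℝ | SobolevRemovability.axisEquiv j (y, t) ∈ K}.Countable := by
    intro j A hA hpos
    obtain ⟨y, hyA, hy⟩ := hno (EuclideanSpace.single j (1 : ℝ)) (by simp) A hA (by
      rwa [SobolevRemovability.lineMeasure, OrthonormalBasis.addHaar_eq_volume])
    exact ⟨y, hyA, SobolevRemovability.countable_slice j hy⟩
  -- The two cases differ only in why `u` is continuous along lines: the capacity estimate in the
  -- first, composition in the second.
  rcases hfail with hfail | hfail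
  · refine hfail (Subset.antisymm ?_
      (inter_subset_inter_right _ SobolevRemovability.sobolev_univ_subset))
    rintro u ⟨huq, hu⟩
    exact ⟨huq, SobolevRemovability.mem_sobolev_univ_of_countable_slices hN hp hK hcount
      (fun j => SobolevRemovability.ae_continuous_slice_of_quasicontinuous j hp huq) hu⟩
  · refine hfail (Subset.antisymm ?_
      (inter_subset_inter_right _ SobolevRemovability.sobolev_univ_subset))
    rintro u ⟨huc, hu⟩
    exact ⟨huc, SobolevRemovability.mem_sobolev_univ_of_countable_slices hN hp hK hcount
      (fun j => .of_forall fun y => Continuous.comp huc (by fun_prop)) hu⟩
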